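/- Let $E/\mathbb{Q}(i)$ be a cyclic Galois extension of degree $n$ with Galois group $\langle\sigma\rangle$, let $\gamma\in\mathbb{Q}(i)^*$, and suppose that the cyclic algebra $$\mathcal D=(E/\mathbb{Q}(i),\sigma,\gamma)=E\oplus uE\oplus\cdots\oplus u^{n-1}E,\qquad xu=u\sigma(x)\ (x\in E),\quad u^n=\gamma,$$ is a division algebra (so $\mathcal D$ is a $\mathbb{Q}(i)$-central division algebra of index $n$). Fix an embedding of $E$ in $\mathbb{C}$ over $\mathbb{Q}(i)$. For $a=x_0+ux_1+\cdots+u^{n-1}x_{n-1}\in\mathcal D$ let $\psi(a)\in M_n(\mathbb{C})$ be the matrix whose entry in row $r$ and column $c$ ($0\le r,c\le n-1$) is $\sigma^c(x_{r-c})$ if $c\le r$ and $\gamma\,\sigma^c(x_{n+r-c})$ if $r<c$. Let $\Lambda$ be a $\mathbb{Z}$-order in $\mathcal D$, that is, a subring with the same identity that is a finitely generated $\mathbb{Z}$-module and spans $\mathcal D$ over $\mathbb{Q}$; let $\Lambda^*$ be its group of units, and let $n_r\ge 2$ be an integer. Write $\|\cdot\|_F$ for the Frobenius norm on $M_n(\mathbb{C})$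 and $B(r)=\{X\in M_n(\mathbb{C}) : \|X\|_F\le r\}$. Then for every real $R$ the set $\{x\in\Lambda : \|\psi(x)\|_F\le R\}$ is finite, and there is a constant $M$, independent of $R$, such that for all $R>0$ $$\sum_{\substack{0\ne x\in\Lambda\\ \|\psi(x)\|_F\le R}}\frac{1}{|\det\psi(x)|^{2nn_r}}\ \le\ M\,\bigl|\psi(\Lambda^*)\cap B(R^n)\bigr|.$$ -/

import Mathlib

open scoped Matrix.Norms.Frobenius

/-- The field `ℚ(i)`, as a subfield of `ℂ`. -/
noncomputable abbrev GaussQ : IntermediateField ℚ ℂ := IntermediateField.adjoin ℚ {Complex.I}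

/-- The structure of a cyclic algebra `(E/ℚ(i), σ, γ)` of degree `n` on a `ℚ(i)`-algebra `D`:
an embedding of `E` in `D` and an element `u` of `D` with `D = E ⊕ uE ⊕ ⋯ ⊕ u^(n-1)E`,
`x u = u σ(x)` for `x ∈ E`, and `u^n = γ`. -/
structure CyclicPresentation {E : Type*} [Field E] [Algebra GaussQ E]
    (σ : E ≃ₐ[GaussQ] E) (γ : GaussQ) (n : ℕ) (D : Type*) [Ring D] [Algebra GaussQ D] where
  incl : E →ₐ[GaussQ] D
  u : D
  incl_mul_u : ∀ x : E, incl x * u = u * incl (σ x)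
  u_pow : u ^ n = algebraMap GaussQ D γ
  bijective_sum : Function.Bijective fun x : Fin n → E => ∑ i : Fin n, u ^ (i : ℕ) * incl (x i)

namespace CyclicPresentation

variable {E : Type*} [Field E] [Algebra GaussQ E] {σ : E ≃ₐ[GaussQ] E} {γ : GaussQ} {n : ℕ}
  {D : Type*} [Ring D] [Algebra GaussQ D]

/-- The coordinates `x_0, …, x_(n-1) ∈ E` of `a = x_0 + u x_1 + ⋯ + u^(n-1) x_(n-1)`. -/
noncomputable def coord (P : CyclicPresentation σ γ n D) (a : D) : Fin n → E :=
  (Equiv.ofBijective _ P.bijective_sum).symm a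

/-- The matrix `ψ(a)` of `a = x_0 + u x_1 + ⋯ + u^(n-1) x_(n-1)`, with `E` embedded in `ℂ` by `ι`.
Its entry in row `r` and column `c` (counted from `0`) is `σ^c(x_(r-c))` if `c ≤ r` and
`γ σ^c(x_(n+r-c))` if `r < c`; the subtraction `r - c` in `Fin n` is modulo `n`. -/
noncomputable def psi (P : CyclicPresentation σ γ n D) (ι : E →ₐ[GaussQ] ℂ) (a : D) :
    Matrix (Fin n) (Fin n) ℂ :=
  Matrix.of fun r c =>
    ι ((if r < c then algebraMap GaussQ E γ else 1) * (σ ^ (c : ℕ)) (P.coord a (r - c)))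

end CyclicPresentation

/-- A `ℤ`-order in `D`: a subring (with the same `1`) that is finitely generated as a `ℤ`-module
and spans `D` over `ℚ`. -/
def IsZOrder {D : Type*} [DivisionRing D] [CharZero D] (Λ : Subring D) : Prop :=
  Module.Finite ℤ Λ ∧ Submodule.span ℚ (Λ : Set D) = ⊤

/-! Up to sign, the integral norm of `x ∈ Λ` is `|det ψ(x)|^(2n)`, and `Λ` has rank `2n²`; this is
all the analysis needs from the cyclic algebra (`CyclicPresentation.norm_int_eq`,
`CyclicPresentation.finrank_rat`).

Group the sum by classes `xΛ*`. If `x₀` and `x` lie in one class and in `B(R)`, then `x₀⁻¹x` is a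
unit, and `‖ψ(x₀)⁻¹‖ ≤ R^(n-1)` because `|det ψ(x₀)| ≥ 1`. So a class has at most `|ψ(Λ*) ∩ B(R^n)|`
terms (`card_le_ncard_units`), all equal.

Each class contains a `y` with `‖ψ(y)‖^(2n²) ≤ C |N(y)|` (`exists_unit_mul_small`): pigeonhole finds
a short element `xz` of `xΛ`, the norm of `z` is then bounded, and up to units only finitely many
such `z` exist. As `n_r ≥ 2`, a class contributes per term at most `C² ‖ψ(y)‖^(-4n²)`, and summing
this over the whole lattice converges because `4n² > 2n²`. -/

theorem Finset.prod_le_sum_pow_card {ι : Type*} (s : Finset ι) (f : ι → ℝ)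
    (hf : ∀ i ∈ s, 0 ≤ f i) : ∏ i ∈ s, f i ≤ (∑ i ∈ s, f i) ^ s.card := by
  calc ∏ i ∈ s, f i ≤ ∏ _i ∈ s, ∑ i ∈ s, f i :=
        Finset.prod_le_prod hf (fun i hi => Finset.single_le_sum hf hi)
    _ = _ := by simp

/-- The products on the left are distinct squarefree monomials in the expansion of the right side.
-/
theorem Finset.sum_prod_erase_le_sum_pow {ι : Type*} [DecidableEq ι] (s : Finset ι)
    (f : ι → ℝ) (hf : ∀ i ∈ s, 0 ≤ f i) (hs : s.Nonempty) :
    ∑ i ∈ s, ∏ j ∈ s.erase i, f j ≤ (∑ i ∈ s, f i) ^ (s.card - 1) := by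
  induction s using Finset.induction_on with
  | empty => exact absurd hs Finset.not_nonempty_empty
  | insert a s ha ih =>
    have hfs : ∀ i ∈ s, 0 ≤ f i := fun i hi => hf i (Finset.mem_insert_of_mem hi)
    have hfa : 0 ≤ f a := hf a (Finset.mem_insert_self _ _)
    rw [Finset.sum_insert ha, Finset.erase_insert ha, Finset.sum_insert ha,
      Finset.card_insert_of_notMem ha, Nat.add_sub_cancel]
    have hT : 0 ≤ ∑ i ∈ s, f i := Finset.sum_nonneg hfs
    have h1 := s.prod_le_sum_pow_card f hfs
    have h2 : ∑ i ∈ s, ∏ j ∈ (insert a s).erase i, f j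
        = f a * ∑ i ∈ s, ∏ j ∈ s.erase i, f j := by
      rw [Finset.mul_sum]
      refine Finset.sum_congr rfl fun i hi => ?_
      have : a ≠ i := fun h => ha (h ▸ hi)
      rw [Finset.erase_insert_of_ne this, Finset.prod_insert (by simp [ha])]
    rw [h2]
    rcases s.eq_empty_or_nonempty with rfl | hs
    · simp
    have h3 := ih hfs hs
    obtain ⟨m, hm⟩ : ∃ m, s.card = m + 1 := ⟨s.card - 1, by have := hs.card_pos; omega⟩
    rw [hm] at h1 h3 ⊢
    simp only [Nat.add_sub_cancel] at h3
    set T := ∑ i ∈ s, f i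
    have h4 : T ^ m ≤ (f a + T) ^ m := by gcongr; linarith
    have h5 : 0 ≤ f a * ((f a + T) ^ m - T ^ m) := mul_nonneg hfa (by linarith)
    have h6 : 0 ≤ T * ((f a + T) ^ m - T ^ m) := mul_nonneg hT (by linarith)
    have h7 := mul_le_mul_of_nonneg_left h3 hfa
    calc _ ≤ T ^ (m + 1) + f a * T ^ m := add_le_add h1 h7
      _ ≤ (f a + T) ^ (m + 1) := by rw [pow_succ, pow_succ]; nlinarith

/-! ### Frobenius norm, determinant and inverse -/

namespace Matrix

open scoped ComplexOrder

variable {n : ℕ} (A : Matrix (Fin n) (Fin n) ℂ)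

theorem trace_mul_conjTranspose_eq_frobenius_norm_sq :
    (A * Aᴴ).trace = ((‖A‖ ^ 2 : ℝ) : ℂ) := by
  have h : ‖A‖ ^ 2 = ∑ i, ∑ j, ‖A i j‖ ^ 2 := by
    rw [frobenius_norm_def, ← Real.sqrt_eq_rpow, Real.sq_sqrt (by positivity)]
    simp
  rw [h]
  simp only [trace, diag_apply, mul_apply, conjTranspose_apply, RCLike.star_def, Complex.mul_conj,
    Complex.normSq_eq_norm_sq]
  push_cast
  rfl

theorem prod_eigenvalues_mul_conjTranspose (h : (A * Aᴴ).IsHermitian) :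
    ∏ i, h.eigenvalues i = ‖A.det‖ ^ 2 := by
  have h1 := h.det_eq_prod_eigenvalues
  rw [det_mul, det_conjTranspose, RCLike.star_def, Complex.mul_conj,
    Complex.normSq_eq_norm_sq] at h1
  apply Complex.ofReal_injective
  rw [h1, Complex.ofReal_prod]
  rfl

theorem sum_eigenvalues_mul_conjTranspose (h : (A * Aᴴ).IsHermitian) :
    ∑ i, h.eigenvalues i = ‖A‖ ^ 2 := by
  have h1 := h.trace_eq_sum_eigenvalues
  rw [trace_mul_conjTranspose_eq_frobenius_norm_sq] at h1
  apply Complex.ofReal_injective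
  rw [h1, Complex.ofReal_sum]
  rfl

theorem norm_det_le_frobenius_norm_pow : ‖A.det‖ ≤ ‖A‖ ^ n := by
  have h := isHermitian_mul_conjTranspose_self A
  have h1 := Finset.univ.prod_le_sum_pow_card h.eigenvalues
    (fun i _ => (posSemidef_self_mul_conjTranspose A).eigenvalues_nonneg i)
  rw [prod_eigenvalues_mul_conjTranspose, sum_eigenvalues_mul_conjTranspose, Finset.card_univ,
    Fintype.card_fin, ← pow_mul, mul_comm, pow_mul] at h1
  exact le_of_sq_le_sq h1 (by positivity)

/-- With `λ_i` the eigenvalues of `A * Aᴴ`, `‖A⁻¹‖² = ∑ 1/λ_i`. Since `∏ λ_j = |det A|² ≥ 1`, each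
`1/λ_i` is at most the product of the other eigenvalues, and `∑ λ_i = ‖A‖²`. -/
theorem frobenius_norm_inv_le (hn : 0 < n) (hA : 1 ≤ ‖A.det‖) : ‖A⁻¹‖ ≤ ‖A‖ ^ (n - 1) := by
  have h := isHermitian_mul_conjTranspose_self A
  have hprod := prod_eigenvalues_mul_conjTranspose A h
  have hnn := fun i => (posSemidef_self_mul_conjTranspose A).eigenvalues_nonneg i
  have hne : ∀ i, h.eigenvalues i ≠ 0 := by
    intro i hi
    rw [Finset.prod_eq_zero (Finset.mem_univ i) hi] at hprod
    nlinarith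
  have h1 := Finset.univ.sum_prod_erase_le_sum_pow h.eigenvalues (fun i _ => hnn i) (Finset.univ_nonempty_iff.2 ⟨⟨0, hn⟩⟩)
  rw [sum_eigenvalues_mul_conjTranspose, Finset.card_univ, Fintype.card_fin] at h1
  have h2 : ∑ i, (h.eigenvalues i)⁻¹ ≤ ∑ i, ∏ j ∈ Finset.univ.erase i, h.eigenvalues j := by
    refine Finset.sum_le_sum fun i _ => ?_
    rw [← Finset.mul_prod_erase _ _ (Finset.mem_univ i)] at hprod
    have hpos : 0 < h.eigenvalues i := lt_of_le_of_ne (hnn i) (hne i).symm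
    rw [inv_le_iff_one_le_mul₀' hpos, hprod]
    exact one_le_pow₀ hA
  have hinv : (A * Aᴴ)⁻¹ = (h.eigenvectorUnitary : Matrix (Fin n) (Fin n) ℂ) *
      (diagonal fun i => ((h.eigenvalues i : ℂ))⁻¹) *
      (star (h.eigenvectorUnitary : Matrix (Fin n) (Fin n) ℂ)) := by
    refine inv_eq_left_inv ?_
    have hs := h.spectral_theorem
    rw [Unitary.conjStarAlgAut_apply] at hs
    have hU : star (h.eigenvectorUnitary : Matrix (Fin n) (Fin n) ℂ) *
      (h.eigenvectorUnitary : Matrix (Fin n) (Fin n) ℂ) = 1 := Unitary.coe_star_mul_self _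
    have hU' : (h.eigenvectorUnitary : Matrix (Fin n) (Fin n) ℂ) *
      star (h.eigenvectorUnitary : Matrix (Fin n) (Fin n) ℂ) = 1 := Unitary.coe_mul_star_self _
    generalize (h.eigenvectorUnitary : Matrix (Fin n) (Fin n) ℂ) = U at *
    have hD : (diagonal fun i => ((h.eigenvalues i : ℂ))⁻¹) *
        (diagonal (RCLike.ofReal ∘ h.eigenvalues)) = (1 : Matrix (Fin n) (Fin n) ℂ) := by
      rw [diagonal_mul_diagonal, ← diagonal_one]
      congr 1
      ext i
      simp [hne i]
    calc _ = U * (diagonal fun i => ((h.eigenvalues i : ℂ))⁻¹) * star U *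
          (U * (diagonal (RCLike.ofReal ∘ h.eigenvalues)) * star U) := by rw [← hs]
      _ = U * (diagonal fun i => ((h.eigenvalues i : ℂ))⁻¹) * (star U * U) *
          (diagonal (RCLike.ofReal ∘ h.eigenvalues)) * star U := by simp only [mul_assoc]
      _ = _ := by rw [hU, mul_one, mul_assoc U, hD, mul_one, hU']
  have htr : ‖A⁻¹‖ ^ 2 = ∑ i, (h.eigenvalues i)⁻¹ := by
    have h3 := trace_mul_conjTranspose_eq_frobenius_norm_sq A⁻¹
    rw [trace_mul_comm, conjTranspose_nonsing_inv, ← mul_inv_rev, hinv, trace_mul_comm,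
      ← mul_assoc, Unitary.coe_star_mul_self, one_mul, trace_diagonal] at h3
    exact_mod_cast h3.symm
  have h4 : ‖A⁻¹‖ ^ 2 ≤ (‖A‖ ^ (n - 1)) ^ 2 := by
    rw [htr, ← pow_mul, mul_comm, pow_mul]
    exact h2.trans h1
  exact le_of_sq_le_sq h4 (by positivity)

end Matrix

/-! ### Norms, units and short elements in a ring that is a lattice -/

section IntegralNorm

variable {L : Type*} [Ring L] [IsDomain L] [Module.Free ℤ L] [Module.Finite ℤ L]

theorem natAbs_norm_eq_card_quotient {x : L} (hx : x ≠ 0) :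
    (Algebra.norm ℤ x).natAbs = Nat.card (L ⧸ LinearMap.range (LinearMap.mulLeft ℤ x)) := by
  have hinj : Function.Injective (LinearMap.mulLeft ℤ x) := fun a b h => mul_left_cancel₀ hx h
  rw [← Submodule.natAbs_det_equiv _ (LinearEquiv.ofInjective _ hinj)]
  rfl

omit [Module.Finite ℤ L] in
theorem norm_int_ne_zero {x : L} (hx : x ≠ 0) : Algebra.norm ℤ x ≠ 0 := by
  intro h
  have hinj : Function.Injective (LinearMap.mulLeft ℤ x) := fun a b h => mul_left_cancel₀ hx h
  have h0 : LinearMap.det (LinearMap.mulLeft ℤ x) = 0 := h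
  have := LinearMap.bot_lt_ker_of_det_eq_zero h0
  rw [LinearMap.ker_eq_bot.2 hinj] at this
  exact lt_irrefl _ this

/-- The finite group `L/xL` is killed by its order, which is `|N(x)|`. -/
theorem exists_mul_eq_natAbs_norm {x : L} (hx : x ≠ 0) :
    ∃ y : L, x * y = ((Algebra.norm ℤ x).natAbs : L) := by
  have h : (Algebra.norm ℤ x).natAbs • (1 : L) ∈ LinearMap.range (LinearMap.mulLeft ℤ x) := by
    rw [natAbs_norm_eq_card_quotient hx]
    set S := LinearMap.range (LinearMap.mulLeft ℤ x)
    rw [← Submodule.Quotient.mk_eq_zero, Submodule.Quotient.mk_smul]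
    exact card_nsmul_eq_zero'
  obtain ⟨y, hy⟩ := h
  exact ⟨y, by simpa using hy⟩

/-- There are finitely many elements of bounded norm, up to multiplication by units on the left. -/
theorem exists_finite_representatives_left_units (T : ℕ) :
    ∃ F : Set L, F.Finite ∧ (∀ y ∈ F, y ≠ 0) ∧
      ∀ x : L, x ≠ 0 → (Algebra.norm ℤ x).natAbs ≤ T → ∃ v : Lˣ, ∃ y ∈ F, x = v * y := by
  classical
  let b := Module.Free.chooseBasis ℤ L
  -- Every positive norm up to `T` divides `T!`, so `m ∈ Lx` for each `x` considered, and elements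
  -- congruent modulo `mL` are left multiples of each other.
  let m := T.factorial
  have hm : m ≠ 0 := T.factorial_ne_zero
  have : NeZero m := ⟨hm⟩
  let red : L → (Module.Free.ChooseBasisIndex ℤ L → ZMod m) := fun x i => (b.repr x i : ZMod m)
  have hred : ∀ x y, red x = red y → ∃ z : L, y = x + (m : L) * z := by
    intro x y hxy
    have h : ∀ i, ∃ c : ℤ, b.repr (y - x) i = m * c := by
      intro i
      have := congrFun hxy i
      rw [ZMod.intCast_eq_intCast_iff_dvd_sub] at this
      rw [map_sub]
      exact this
    choose c hc using h
    refine ⟨∑ i, c i • b i, ?_⟩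
    rw [← sub_eq_iff_eq_add', ← b.sum_repr (y - x), Finset.mul_sum]
    refine Finset.sum_congr rfl fun i _ => ?_
    rw [hc, mul_smul, zsmul_eq_mul]
    simp
  have hdiv : ∀ x : L, x ≠ 0 → (Algebra.norm ℤ x).natAbs ≤ T → ∃ z : L, z * x = (m : L) := by
    intro x hx hT
    obtain ⟨y, hy⟩ := exists_mul_eq_natAbs_norm hx
    -- The norm is an integer, hence central, so the right cofactor is also a left cofactor.
    have hy' : y * x = ((Algebra.norm ℤ x).natAbs : L) := by
      apply mul_left_cancel₀ hx
      rw [← mul_assoc, hy]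
      exact Nat.cast_commute _ _
    obtain ⟨k, hk⟩ := Nat.dvd_factorial
      (Nat.pos_of_ne_zero (Int.natAbs_ne_zero.2 (norm_int_ne_zero hx))) hT
    refine ⟨k * y, ?_⟩
    rw [mul_assoc, hy', ← Nat.cast_mul, mul_comm, ← hk]
  have hmul : ∀ x y : L, x ≠ 0 → (Algebra.norm ℤ x).natAbs ≤ T → red x = red y →
      ∃ v : L, y = v * x := by
    intro x y hx hT hxy
    obtain ⟨z, hz⟩ := hred x y hxy
    obtain ⟨w, hw⟩ := hdiv x hx hT
    refine ⟨1 + z * w, ?_⟩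
    rw [hz, add_mul, one_mul, mul_assoc, hw, (Nat.cast_commute m z).eq]
  let S : Set L := {x | x ≠ 0 ∧ (Algebra.norm ℤ x).natAbs ≤ T}
  -- One representative for each residue class modulo `m` that occurs; there are finitely many
  -- classes.
  obtain ⟨F, hFS, hF⟩ := Set.exists_subset_bijOn S red
  refine ⟨F, hF.finite_iff_finite.2 (Set.toFinite _), fun y hy => (hFS hy).1, fun x hx hT => ?_⟩
  obtain ⟨y, hyF, hyx⟩ := hF.surjOn ⟨x, ⟨hx, hT⟩, rfl⟩
  obtain ⟨hy0, hyT⟩ := hFS hyF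
  obtain ⟨v, hv⟩ := hmul y x hy0 hyT hyx
  obtain ⟨w, hw⟩ := hmul x y hx hT hyx.symm
  refine ⟨⟨v, w, ?_, ?_⟩, y, hyF, hv⟩
  · apply mul_right_cancel₀ hx
    rw [mul_assoc, ← hw, ← hv, one_mul]
  · apply mul_right_cancel₀ hy0
    rw [mul_assoc, ← hv, ← hw, one_mul]

theorem exists_pow_le_lt_succ_pow {d : ℕ} (hd : 0 < d) (N : ℕ) :
    ∃ k : ℕ, k ^ d ≤ N ∧ N < (k + 1) ^ d := by
  classical
  have h : ∃ k : ℕ, N < (k + 1) ^ d := ⟨N, N.lt_succ_self.trans_le (Nat.le_self_pow hd.ne' _)⟩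
  refine ⟨Nat.find h, ?_, Nat.find_spec h⟩
  by_contra! hlt
  rcases hk : Nat.find h with _ | j
  · rw [hk, zero_pow hd.ne'] at hlt
    omega
  · exact Nat.find_min h (m := j) (by omega) (by rwa [hk] at hlt)

/-- By the pigeonhole principle, the right ideal `xL` has a nonzero element with small coordinates
in any given basis. -/
theorem exists_ne_zero_mul_eq_sum_small {ι : Type*} [Fintype ι] [Nonempty ι]
    (b : Module.Basis ι ℤ L) {x : L} (hx : x ≠ 0) :
    ∃ k : ℕ, k ^ Fintype.card ι ≤ (Algebra.norm ℤ x).natAbs ∧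
      ∃ c : ι → ℤ, (∀ i, |c i| ≤ k) ∧ ∃ y : L, y ≠ 0 ∧ x * y = ∑ i, c i • b i := by
  classical
  obtain ⟨k, hk, hk'⟩ := exists_pow_le_lt_succ_pow (Fintype.card_pos (α := ι))
    (Algebra.norm ℤ x).natAbs
  refine ⟨k, hk, ?_⟩
  set S := LinearMap.range (LinearMap.mulLeft ℤ x) with hS
  have hcard := natAbs_norm_eq_card_quotient hx
  have hpos : 0 < Nat.card (L ⧸ S) := by
    rw [← hcard]; exact Nat.pos_of_ne_zero (Int.natAbs_ne_zero.2 (norm_int_ne_zero hx))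
  have : Finite (L ⧸ S) := (Nat.card_pos_iff.1 hpos).2
  have := Fintype.ofFinite (L ⧸ S)
  -- Coefficients in `0..k` give `(k+1)^d > |N(x)| = |L/xL|` vectors, so two collide; their
  -- difference has coefficients of size at most `k`.
  let f : (ι → Fin (k + 1)) → L ⧸ S := fun c => S.mkQ (∑ i, ((c i : ℕ) : ℤ) • b i)
  obtain ⟨p, q, hpq, hf⟩ := Fintype.exists_ne_map_eq_of_card_lt f (by
    rw [Fintype.card_fun, Fintype.card_fin, ← Nat.card_eq_fintype_card (α := L ⧸ S), ← hcard]
    exact hk')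
  have hmem : ∑ i, (((p i : ℕ) : ℤ) - ((q i : ℕ) : ℤ)) • b i ∈ S := by
    have := (Submodule.Quotient.eq S).1 hf
    simpa [sub_smul, Finset.sum_sub_distrib] using this
  refine ⟨fun i => ((p i : ℕ) : ℤ) - ((q i : ℕ) : ℤ), fun i => ?_, ?_⟩
  · have := (p i).2
    have := (q i).2
    simp only [abs_le]
    omega
  obtain ⟨y, hy⟩ := hmem
  refine ⟨y, ?_, hy⟩
  rintro rfl
  simp only [LinearMap.mulLeft_apply, mul_zero] at hy
  apply hpq
  have h0 := Fintype.linearIndependent_iff.1 b.linearIndependent _ hy.symm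
  ext i
  have := h0 i
  omega

end IntegralNorm

/-! ### Small representatives modulo units -/

section Representation

variable {L : Type*} [Ring L] [IsDomain L] [Module.Free ℤ L] [Module.Finite ℤ L]
  {n : ℕ} (ψ : L →+* Matrix (Fin n) (Fin n) ℂ)

omit [Module.Finite ℤ L] in
theorem one_le_norm_det_of_norm_eq
    (hψ : ∀ x, ((Algebra.norm ℤ x).natAbs : ℝ) = ‖(ψ x).det‖ ^ (2 * n))
    {x : L} (hx : x ≠ 0) : 1 ≤ ‖(ψ x).det‖ := by
  have h : (1 : ℝ) ≤ ((Algebra.norm ℤ x).natAbs : ℝ) := by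
    exact_mod_cast Nat.pos_of_ne_zero (Int.natAbs_ne_zero.2 (norm_int_ne_zero hx))
  rw [hψ] at h
  by_contra! hlt
  rcases Nat.eq_zero_or_pos n with rfl | hn
  · simp at hlt
  · exact absurd h (not_le.2 (pow_lt_one₀ (norm_nonneg _) hlt (by omega)))

/-- Each nonzero element of `L` is a right unit multiple of one that is small with respect to its
norm. -/
theorem exists_unit_mul_small (hn : 0 < n)
    (hψ : ∀ x, ((Algebra.norm ℤ x).natAbs : ℝ) = ‖(ψ x).det‖ ^ (2 * n))
    (hrank : Module.finrank ℤ L = 2 * n ^ 2) :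
    ∃ C : ℝ, 0 < C ∧ ∀ x : L, x ≠ 0 →
      ∃ v : Lˣ, ‖ψ (x * v)‖ ^ (2 * n ^ 2) ≤ C * (Algebra.norm ℤ x).natAbs := by
  classical
  let b := Module.finBasisOfFinrankEq ℤ L hrank
  have hd : 0 < 2 * n ^ 2 := by positivity
  have : Nonempty (Fin (2 * n ^ 2)) := ⟨⟨0, hd⟩⟩
  set B : ℝ := ∑ i, ‖ψ (b i)‖
  have hB : 0 ≤ B := Finset.sum_nonneg fun _ _ => norm_nonneg _
  obtain ⟨F, hF, hF0, hFrep⟩ :=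
    exists_finite_representatives_left_units (L := L) ⌊B ^ (2 * n ^ 2)⌋₊
  obtain ⟨C₀, hC₀⟩ := (hF.image fun y => ‖(ψ y)⁻¹‖).bddAbove
  -- `C₀` is just some upper bound, hence the absolute value; the `+ 1` makes the constant positive.
  refine ⟨(B * |C₀|) ^ (2 * n ^ 2) + 1, by positivity, fun x hx => ?_⟩
  obtain ⟨k, hk, c, hc, y, hy, hxy⟩ := exists_ne_zero_mul_eq_sum_small b hx
  rw [Fintype.card_fin] at hk
  have hkR : (k : ℝ) ^ (2 * n ^ 2) ≤ ((Algebra.norm ℤ x).natAbs : ℝ) := by exact_mod_cast hk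
  have hz : ‖ψ (x * y)‖ ≤ k * B := by
    rw [hxy, map_sum, Finset.mul_sum]
    refine norm_sum_le_of_le _ fun i _ => ?_
    rw [zsmul_eq_mul, map_mul, map_intCast, ← zsmul_eq_mul]
    refine (norm_zsmul_le _ _).trans ?_
    gcongr
    rw [Int.norm_eq_abs]
    exact_mod_cast hc i
  have hxpos : (0 : ℝ) < ((Algebra.norm ℤ x).natAbs : ℝ) := by
    exact_mod_cast Nat.pos_of_ne_zero (Int.natAbs_ne_zero.2 (norm_int_ne_zero hx))
  -- The bound on `|N(xy)|` contains the factor `k^(2n²) ≤ |N(x)|`, so `N(x)` cancels.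
  have hNy : (Algebra.norm ℤ y).natAbs ≤ ⌊B ^ (2 * n ^ 2)⌋₊ := by
    apply Nat.le_floor
    have h1 : ((Algebra.norm ℤ x).natAbs : ℝ) * ((Algebra.norm ℤ y).natAbs : ℝ) ≤
        ((Algebra.norm ℤ x).natAbs : ℝ) * B ^ (2 * n ^ 2) := by
      calc ((Algebra.norm ℤ x).natAbs : ℝ) * ((Algebra.norm ℤ y).natAbs : ℝ)
          = ((Algebra.norm ℤ (x * y)).natAbs : ℝ) := by
            rw [map_mul, Int.natAbs_mul, Nat.cast_mul]
        _ = ‖(ψ (x * y)).det‖ ^ (2 * n) := hψ _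
        _ ≤ (‖ψ (x * y)‖ ^ n) ^ (2 * n) := by
            gcongr; exact Matrix.norm_det_le_frobenius_norm_pow _
        _ = ‖ψ (x * y)‖ ^ (2 * n ^ 2) := by rw [← pow_mul]; congr 1; ring
        _ ≤ (k * B) ^ (2 * n ^ 2) := by gcongr
        _ ≤ _ := by rw [mul_pow]; gcongr
    exact le_of_mul_le_mul_left h1 hxpos
  obtain ⟨v, w, hw, hyw⟩ := hFrep y hy hNy
  refine ⟨v, ?_⟩
  have hdet : IsUnit (ψ w).det := by
    have := one_le_norm_det_of_norm_eq ψ hψ (hF0 w hw)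
    rw [isUnit_iff_ne_zero]
    intro h0
    rw [h0, norm_zero] at this
    linarith
  have hxv : ψ (x * v) = ψ (x * y) * (ψ w)⁻¹ := by
    rw [hyw, ← mul_assoc, map_mul ψ (x * v), mul_assoc, Matrix.mul_nonsing_inv _ hdet, mul_one]
  have hle : ‖ψ (x * v)‖ ≤ k * (B * |C₀|) := by
    rw [hxv, ← mul_assoc]
    refine (Matrix.frobenius_norm_mul _ _).trans ?_
    gcongr
    exact (hC₀ ⟨w, hw, rfl⟩).trans (le_abs_self _)
  calc ‖ψ (x * v)‖ ^ (2 * n ^ 2) ≤ (k * (B * |C₀|)) ^ (2 * n ^ 2) := by gcongr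
    _ = (B * |C₀|) ^ (2 * n ^ 2) * (k : ℝ) ^ (2 * n ^ 2) := by ring
    _ ≤ ((B * |C₀|) ^ (2 * n ^ 2) + 1) * ((Algebra.norm ℤ x).natAbs : ℝ) := by
        gcongr; linarith

end Representation

/-! ### Lattice points in balls and convergent lattice sums -/

section DiscreteImage

variable {L : Type*} [AddCommGroup L] {V : Type*} [NormedAddCommGroup V] [NormedSpace ℝ V]
  [FiniteDimensional ℝ V] (f : L →ₗ[ℤ] V)

omit [NormedSpace ℝ V] [FiniteDimensional ℝ V] in
theorem injective_of_one_le_norm (hf : ∀ x ≠ 0, 1 ≤ ‖f x‖) : Function.Injective f := by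
  rw [injective_iff_map_eq_zero]
  intro x hx
  by_contra h
  have := hf x h
  rw [hx, norm_zero] at this
  linarith

omit [NormedSpace ℝ V] [FiniteDimensional ℝ V] in
theorem discreteTopology_range_of_one_le_norm (hf : ∀ x ≠ 0, 1 ≤ ‖f x‖) :
    DiscreteTopology (LinearMap.range f) := by
  refine discreteTopology_of_isOpen_singleton_zero ?_
  rw [Metric.isOpen_singleton_iff]
  refine ⟨1, one_pos, ?_⟩
  rintro ⟨_, x, rfl⟩ h
  by_contra hne
  have hx : x ≠ 0 := by
    rintro rfl
    exact hne (Subtype.ext (map_zero _))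
  rw [dist_zero_right] at h
  exact absurd h (not_lt.2 (hf x hx))

theorem finite_setOf_norm_le_of_one_le_norm (hf : ∀ x ≠ 0, 1 ≤ ‖f x‖) (R : ℝ) :
    {x : L | ‖f x‖ ≤ R}.Finite := by
  have hdisc := discreteTopology_range_of_one_le_norm f hf
  have hcl : IsClosed (LinearMap.range f : Set V) :=
    @AddSubgroup.isClosed_of_discrete _ _ _ _ _ (LinearMap.range f).toAddSubgroup hdisc
  have : ProperSpace V := FiniteDimensional.proper_real _
  have hfin := Metric.finite_isBounded_inter_isClosed
    (@DiscreteTopology.isDiscrete _ _ (LinearMap.range f : Set V) hdisc)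
    (Metric.isBounded_closedBall (x := (0 : V)) (r := R)) hcl
  refine (hfin.preimage (injective_of_one_le_norm f hf).injOn).subset fun x hx => ⟨?_, x, rfl⟩
  simpa using hx

theorem summable_norm_inv_pow_of_one_le_norm (hf : ∀ x ≠ 0, 1 ≤ ‖f x‖) {k : ℕ}
    (hk : Module.finrank ℤ L < k) : Summable fun x : L => ‖f x‖⁻¹ ^ k := by
  have hdisc := discreteTopology_range_of_one_le_norm f hf
  let e := LinearEquiv.ofInjective f (injective_of_one_le_norm f hf)
  have h := ZLattice.summable_norm_pow_inv (L := LinearMap.range f) k (by rwa [← e.finrank_eq])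
  exact (e.toEquiv.summable_iff).2 h

end DiscreteImage

/-! ### Counting by associate classes -/

section Counting

variable {L : Type*} [Ring L] [IsDomain L] [Module.Free ℤ L] [Module.Finite ℤ L]
  {n : ℕ} (ψ : L →+* Matrix (Fin n) (Fin n) ℂ)

omit [Module.Finite ℤ L] in
theorem one_le_norm_of_norm_eq (hn : 0 < n)
    (hψ : ∀ x, ((Algebra.norm ℤ x).natAbs : ℝ) = ‖(ψ x).det‖ ^ (2 * n))
    {x : L} (hx : x ≠ 0) : 1 ≤ ‖ψ x‖ := by
  have h := (one_le_norm_det_of_norm_eq ψ hψ hx).trans (Matrix.norm_det_le_frobenius_norm_pow _)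
  by_contra! hlt
  exact absurd h (not_le.2 (pow_lt_one₀ (norm_nonneg _) hlt hn.ne'))

omit [Module.Finite ℤ L] in
theorem injective_of_norm_eq (hn : 0 < n)
    (hψ : ∀ x, ((Algebra.norm ℤ x).natAbs : ℝ) = ‖(ψ x).det‖ ^ (2 * n)) :
    Function.Injective ψ := by
  rw [injective_iff_map_eq_zero]
  intro x hx
  by_contra h
  have := one_le_norm_of_norm_eq ψ hn hψ h
  rw [hx, norm_zero] at this
  linarith

omit [Module.Finite ℤ L] in
theorem finite_setOf_norm_le_of_norm_eq (hn : 0 < n)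
    (hψ : ∀ x, ((Algebra.norm ℤ x).natAbs : ℝ) = ‖(ψ x).det‖ ^ (2 * n)) (R : ℝ) :
    {x : L | ‖ψ x‖ ≤ R}.Finite :=
  finite_setOf_norm_le_of_one_le_norm ψ.toAddMonoidHom.toIntLinearMap
    (fun _ hx => one_le_norm_of_norm_eq ψ hn hψ hx) R

omit [Module.Finite ℤ L] in
theorem summable_norm_inv_pow_of_norm_eq (hn : 0 < n)
    (hψ : ∀ x, ((Algebra.norm ℤ x).natAbs : ℝ) = ‖(ψ x).det‖ ^ (2 * n)) {k : ℕ}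
    (hk : Module.finrank ℤ L < k) : Summable fun x : L => ‖ψ x‖⁻¹ ^ k :=
  summable_norm_inv_pow_of_one_le_norm ψ.toAddMonoidHom.toIntLinearMap
    (fun _ hx => one_le_norm_of_norm_eq ψ hn hψ hx) hk

omit [Module.Finite ℤ L] in
theorem card_le_ncard_units (hn : 0 < n)
    (hψ : ∀ x, ((Algebra.norm ℤ x).natAbs : ℝ) = ‖(ψ x).det‖ ^ (2 * n)) {R : ℝ}
    (s : Finset L) (hs : ∀ x ∈ s, x ≠ 0 ∧ ‖ψ x‖ ≤ R)
    (hassoc : ∀ x ∈ s, ∀ y ∈ s, Associated x y) :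
    s.card ≤ (Set.range (fun v : Lˣ => ψ v) ∩ {X | ‖X‖ ≤ R ^ n}).ncard := by
  rcases s.eq_empty_or_nonempty with rfl | ⟨x₀, hx₀⟩
  · simp
  have hfin : (Set.range (fun v : Lˣ => ψ v) ∩ {X | ‖X‖ ≤ R ^ n}).Finite := by
    refine ((finite_setOf_norm_le_of_norm_eq ψ hn hψ (R ^ n)).image ψ).subset ?_
    rintro _ ⟨⟨v, rfl⟩, hv⟩
    exact ⟨v, hv, rfl⟩
  have hdet := one_le_norm_det_of_norm_eq ψ hψ (hs x₀ hx₀).1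
  have hunit : IsUnit (ψ x₀).det := by
    rw [isUnit_iff_ne_zero]
    intro h0
    rw [h0, norm_zero] at hdet
    linarith
  rw [← Set.ncard_coe_finset]
  refine Set.ncard_le_ncard_of_injOn (fun x => (ψ x₀)⁻¹ * ψ x) ?_ ?_ hfin
  · intro x hx
    obtain ⟨v, hv⟩ := hassoc x₀ hx₀ x hx
    refine ⟨⟨v, ?_⟩, ?_⟩
    · simp only [← hv, map_mul]
      rw [← mul_assoc, Matrix.nonsing_inv_mul _ hunit, one_mul]
    · have hR : 0 ≤ R := (norm_nonneg _).trans (hs x₀ hx₀).2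
      calc ‖(ψ x₀)⁻¹ * ψ x‖ ≤ ‖(ψ x₀)⁻¹‖ * ‖ψ x‖ := Matrix.frobenius_norm_mul _ _
        _ ≤ R ^ (n - 1) * R := by
            refine mul_le_mul ?_ (hs x hx).2 (norm_nonneg _) (by positivity)
            refine (Matrix.frobenius_norm_inv_le _ hn hdet).trans ?_
            exact pow_le_pow_left₀ (norm_nonneg _) (hs x₀ hx₀).2 _
        _ = R ^ n := by rw [← pow_succ, Nat.sub_add_cancel hn]
  · intro x _ y _ hxy
    apply injective_of_norm_eq ψ hn hψ
    have := congrArg (fun X => ψ x₀ * X) hxy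
    simpa only [← mul_assoc, Matrix.mul_nonsing_inv _ hunit, one_mul] using this

theorem exists_sum_inv_det_pow_le (hn : 0 < n)
    (hψ : ∀ x, ((Algebra.norm ℤ x).natAbs : ℝ) = ‖(ψ x).det‖ ^ (2 * n))
    (hrank : Module.finrank ℤ L = 2 * n ^ 2) {r : ℕ} (hr : 2 ≤ r) :
    ∃ M : ℝ, ∀ R : ℝ, ∀ s : Finset L, (∀ x ∈ s, x ≠ 0 ∧ ‖ψ x‖ ≤ R) →
      ∑ x ∈ s, 1 / ‖(ψ x).det‖ ^ (2 * n * r) ≤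
        M * (Set.range (fun v : Lˣ => ψ v) ∩ {X | ‖X‖ ≤ R ^ n}).ncard := by
  classical
  obtain ⟨C, hC, hsmall⟩ := exists_unit_mul_small ψ hn hψ hrank
  have hsum : Summable fun x : L => ‖ψ x‖⁻¹ ^ (2 * n ^ 2 * 2) :=
    summable_norm_inv_pow_of_norm_eq ψ hn hψ (by rw [hrank]; have := pow_pos hn 2; omega)
  -- `Associated` multiplies by units on the right, so classes are the sets `xL*`; the zero class
  -- gets a junk representative.
  have hrep : ∀ q : Associates L, ∃ y : L, q ≠ Associates.mk 0 → Associates.mk y = q ∧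
      ‖ψ y‖ ^ (2 * n ^ 2) ≤ C * (Algebra.norm ℤ y).natAbs := by
    intro q
    obtain ⟨x, rfl⟩ := Associates.mk_surjective q
    by_cases hx : x = 0
    · exact ⟨0, fun h => absurd (by rw [hx]) h⟩
    obtain ⟨v, hv⟩ := hsmall x hx
    refine ⟨x * v, fun _ => ⟨?_, ?_⟩⟩
    · exact Associates.mk_eq_mk_iff_associated.2 (Associated.symm ⟨v, rfl⟩)
    · rw [map_mul (Algebra.norm ℤ), Int.natAbs_mul,
        Int.isUnit_iff_natAbs_eq.1 (v.isUnit.map (Algebra.norm ℤ)),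
        mul_one]
      exact hv
  choose rep hrep using hrep
  let ρ : L → L := fun x => rep (Associates.mk x)
  have hρ : ∀ x, x ≠ 0 → Associated (ρ x) x ∧
      ‖ψ (ρ x)‖ ^ (2 * n ^ 2) ≤ C * (Algebra.norm ℤ (ρ x)).natAbs := by
    intro x hx
    have hne : Associates.mk x ≠ Associates.mk 0 := by
      rw [Ne, Associates.mk_eq_mk_iff_associated]
      rintro h
      obtain ⟨v, hv⟩ := h.symm
      exact hx (by rw [← hv, zero_mul])
    exact ⟨Associates.mk_eq_mk_iff_associated.1 (hrep _ hne).1, (hrep _ hne).2⟩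
  refine ⟨C ^ 2 * ∑' x : L, ‖ψ x‖⁻¹ ^ (2 * n ^ 2 * 2), fun R s hs => ?_⟩
  set U := (Set.range (fun v : Lˣ => ψ v) ∩ {X | ‖X‖ ≤ R ^ n}).ncard
  have hterm : ∀ x ∈ s, 1 / ‖(ψ x).det‖ ^ (2 * n * r) ≤ C ^ 2 * ‖ψ (ρ x)‖⁻¹ ^ (2 * n ^ 2 * 2) := by
    intro x hx
    have hx0 := (hs x hx).1
    obtain ⟨⟨v, hv⟩, hle⟩ := hρ x hx0
    have hy0 : ρ x ≠ 0 := by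
      intro h
      rw [h, zero_mul] at hv
      exact hx0 hv.symm
    have hN : (Algebra.norm ℤ (ρ x)).natAbs = (Algebra.norm ℤ x).natAbs := by
      conv_rhs => rw [← hv]
      rw [map_mul, Int.natAbs_mul,
        Int.isUnit_iff_natAbs_eq.1 (v.isUnit.map (Algebra.norm ℤ)), mul_one]
    have hpos : 0 < ‖ψ (ρ x)‖ := one_pos.trans_le (one_le_norm_of_norm_eq ψ hn hψ hy0)
    have h1 : (1 : ℝ) ≤ (Algebra.norm ℤ x).natAbs := by
      exact_mod_cast Nat.pos_of_ne_zero (Int.natAbs_ne_zero.2 (norm_int_ne_zero hx0))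
    rw [pow_mul, ← hψ, inv_pow, pow_mul, ← div_eq_mul_inv]
    rw [hN] at hle
    -- Norms are at least 1, so the exponent can be lowered to 2, which already exceeds the
    -- threshold for convergence.
    calc 1 / ((Algebra.norm ℤ x).natAbs : ℝ) ^ r ≤ 1 / ((Algebra.norm ℤ x).natAbs : ℝ) ^ 2 := by
          gcongr
      _ ≤ _ := by
          rw [div_le_div_iff₀ (by positivity) (by positivity), one_mul, ← mul_pow]
          gcongr
  calc ∑ x ∈ s, 1 / ‖(ψ x).det‖ ^ (2 * n * r)
      ≤ ∑ x ∈ s, C ^ 2 * ‖ψ (ρ x)‖⁻¹ ^ (2 * n ^ 2 * 2) := Finset.sum_le_sum hterm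
    _ = ∑ y ∈ s.image ρ, ∑ x ∈ s with ρ x = y, C ^ 2 * ‖ψ (ρ x)‖⁻¹ ^ (2 * n ^ 2 * 2) :=
        (Finset.sum_fiberwise_of_maps_to (fun x hx => Finset.mem_image_of_mem _ hx) _).symm
    _ ≤ ∑ y ∈ s.image ρ, U * (C ^ 2 * ‖ψ y‖⁻¹ ^ (2 * n ^ 2 * 2)) := by
        refine Finset.sum_le_sum fun y _ => ?_
        rw [Finset.sum_congr rfl (g := fun _ => C ^ 2 * ‖ψ y‖⁻¹ ^ (2 * n ^ 2 * 2))
          (fun x hx => by rw [(Finset.mem_filter.1 hx).2]), Finset.sum_const, nsmul_eq_mul]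
        gcongr
        refine card_le_ncard_units ψ hn hψ _
          (fun x hx => hs x (Finset.mem_filter.1 hx).1) fun x hx x' hx' => ?_
        obtain ⟨hx, hxy⟩ := Finset.mem_filter.1 hx
        obtain ⟨hx', hxy'⟩ := Finset.mem_filter.1 hx'
        have h1 := (hρ x (hs x hx).1).1
        have h2 := (hρ x' (hs x' hx').1).1
        rw [hxy] at h1
        rw [hxy'] at h2
        exact h1.symm.trans h2
    _ = C ^ 2 * (∑ y ∈ s.image ρ, ‖ψ y‖⁻¹ ^ (2 * n ^ 2 * 2)) * U := by
        rw [← Finset.mul_sum, ← Finset.mul_sum]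
        ring
    _ ≤ _ := by
        gcongr
        -- Distinct classes give distinct points of the image of `ρ`, so a sum over all of `L`
        -- dominates; its term at zero is `0⁻¹ ^ k = 0`.
        exact hsum.sum_le_tsum _ fun _ _ => by positivity

end Counting

/-! ### Degree and norm of `ℚ(i)` -/

section GaussQ

theorem isIntegral_I : IsIntegral ℚ Complex.I :=
  ⟨Polynomial.X ^ 2 + 1, by monicity!, by simp⟩

instance finiteDimensional_gaussQ : FiniteDimensional ℚ GaussQ :=
  IntermediateField.adjoin.finiteDimensional isIntegral_I

theorem finrank_gaussQ : Module.finrank ℚ GaussQ = 2 := by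
  have hI : minpoly ℚ Complex.I = Polynomial.X ^ 2 + 1 := by
    have hm : (Polynomial.X ^ 2 + 1 : Polynomial ℚ).Monic := by monicity!
    have hd : (Polynomial.X ^ 2 + 1 : Polynomial ℚ).natDegree = 2 := by compute_degree!
    refine (minpoly.eq_of_irreducible_of_monic ?_ (by simp) hm).symm
    rw [Polynomial.Monic.irreducible_iff_roots_eq_zero_of_degree_le_three hm
      (by rw [hd]) (by rw [hd]; norm_num)]
    rw [Multiset.eq_zero_iff_forall_notMem]
    intro x hx
    have := (Polynomial.mem_roots'.1 hx).2
    simp only [Polynomial.IsRoot.def, Polynomial.eval_add, Polynomial.eval_pow,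
      Polynomial.eval_X, Polynomial.eval_one] at this
    nlinarith [sq_nonneg x]
  rw [IntermediateField.adjoin.finrank isIntegral_I, hI]
  compute_degree!

theorem norm_gaussQ (z : GaussQ) : ((Algebra.norm ℚ z : ℚ) : ℝ) = ‖(z : ℂ)‖ ^ 2 := by
  classical
  have h := Algebra.norm_eq_prod_embeddings ℚ ℂ z
  let f : GaussQ →ₐ[ℚ] ℂ := GaussQ.val
  let g : GaussQ →ₐ[ℚ] ℂ := (Complex.conjAe.toAlgHom.restrictScalars ℚ).comp GaussQ.val
  have hfg : f ≠ g := by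
    intro hfg
    have hI : Complex.I ∈ GaussQ := IntermediateField.mem_adjoin_simple_self ℚ _
    have := DFunLike.congr_fun hfg ⟨Complex.I, hI⟩
    have h2 : Complex.I = (starRingEnd ℂ) Complex.I := this
    rw [Complex.conj_I] at h2
    have := congrArg Complex.im h2
    simp at this
    norm_num at this
  have huniv : (Finset.univ : Finset (GaussQ →ₐ[ℚ] ℂ)) = {f, g} := by
    symm
    apply Finset.eq_univ_of_card
    rw [Finset.card_pair hfg, AlgHom.card, finrank_gaussQ]
  rw [huniv, Finset.prod_pair hfg] at h
  have h3 : f z * g z = ((‖(z : ℂ)‖ ^ 2 : ℝ) : ℂ) := by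
    rw [← Complex.normSq_eq_norm_sq]
    exact Complex.mul_conj _
  rw [h3] at h
  apply Complex.ofReal_injective
  rw [← h]
  simp

end GaussQ

/-! ### The left regular representation over `E` -/

namespace CyclicPresentation

variable {E : Type*} [Field E] [Algebra GaussQ E] {σ : E ≃ₐ[GaussQ] E} {γ : GaussQ} {n : ℕ}
  {D : Type*} [Ring D] [Algebra GaussQ D] (P : CyclicPresentation σ γ n D)

theorem sum_coord (a : D) : ∑ i : Fin n, P.u ^ (i : ℕ) * P.incl (P.coord a i) = a :=
  (Equiv.ofBijective _ P.bijective_sum).apply_symm_apply a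

theorem coord_sum (x : Fin n → E) : P.coord (∑ i : Fin n, P.u ^ (i : ℕ) * P.incl (x i)) = x :=
  (Equiv.ofBijective _ P.bijective_sum).symm_apply_apply x

/-- The coordinates as a linear equivalence. -/
noncomputable def coordEquiv : D ≃ₗ[GaussQ] (Fin n → E) :=
  (LinearEquiv.ofBijective
    (M := Fin n → E) (M₂ := D)
    { toFun := fun x : Fin n → E => ∑ i : Fin n, P.u ^ (i : ℕ) * P.incl (x i)
      map_add' := fun x y => by simp [mul_add, Finset.sum_add_distrib]
      map_smul' := fun c x => by simp [Finset.smul_sum] } P.bijective_sum).symm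

theorem coordEquiv_apply (a : D) : P.coordEquiv a = P.coord a := by
  rw [coordEquiv, LinearEquiv.symm_apply_eq]
  exact (P.sum_coord a).symm

theorem incl_mul_u_pow (x : E) (c : ℕ) : P.incl x * P.u ^ c = P.u ^ c * P.incl ((σ ^ c) x) := by
  induction c generalizing x with
  | zero => simp
  | succ c ih =>
    rw [pow_succ, ← mul_assoc, ih, mul_assoc, P.incl_mul_u, ← mul_assoc, pow_succ' σ]
    rfl

/-- The matrix of left multiplication by `a` on the right `E`-vector space `D` with basis
`1, u, …, u^(n-1)`. -/
noncomputable def leftMatrix (a : D) : Matrix (Fin n) (Fin n) E :=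
  Matrix.of fun r c =>
    (if r < c then algebraMap GaussQ E γ else 1) * (σ ^ (c : ℕ)) (P.coord a (r - c))

theorem psi_eq_map (ι : E →ₐ[GaussQ] ℂ) (a : D) : P.psi ι a = (P.leftMatrix a).map ι := rfl

theorem mul_u_pow (a : D) (c : Fin n) :
    a * P.u ^ (c : ℕ) = ∑ r : Fin n, P.u ^ (r : ℕ) * P.incl (P.leftMatrix a r c) := by
  have : NeZero n := ⟨by have := c.2; omega⟩
  conv_lhs => rw [← P.sum_coord a, Finset.sum_mul]
  rw [← Equiv.sum_comp (Equiv.addRight c)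
    (fun r : Fin n => P.u ^ (r : ℕ) * P.incl (P.leftMatrix a r c))]
  refine Finset.sum_congr rfl fun i _ => ?_
  rw [mul_assoc, P.incl_mul_u_pow, ← mul_assoc, ← pow_add]
  simp only [leftMatrix, Matrix.of_apply, Equiv.coe_addRight, add_sub_cancel_right]
  have hval : ((i + c : Fin n) : ℕ) = if n ≤ (i : ℕ) + c then (i : ℕ) + c - n else (i : ℕ) + c :=
    Fin.val_add_eq_ite i c
  -- When the exponent wraps past `n`, `u^n = γ` supplies the factor above the diagonal.
  by_cases h : n ≤ (i : ℕ) + c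
  · rw [if_pos h] at hval
    have hlt : i + c < c := by rw [Fin.lt_def, hval]; have := i.2; omega
    rw [if_pos hlt, map_mul, AlgHom.commutes, hval, ← P.u_pow, ← mul_assoc, ← pow_add,
      Nat.sub_add_cancel h]
  · rw [if_neg h] at hval
    have hlt : ¬ i + c < c := by rw [Fin.lt_def, hval]; omega
    rw [if_neg hlt, one_mul, hval]

theorem coord_mul (a b : D) : P.coord (a * b) = (P.leftMatrix a).mulVec (P.coord b) := by
  rw [← P.coord_sum ((P.leftMatrix a).mulVec (P.coord b))]
  congr 1
  conv_lhs => rw [← P.sum_coord b, Finset.mul_sum]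
  simp_rw [← mul_assoc, mul_u_pow, Matrix.mulVec, dotProduct, map_sum, map_mul, Finset.sum_mul,
    Finset.mul_sum, mul_assoc]
  exact Finset.sum_comm

/-- `leftMatrix` as a ring homomorphism. -/
noncomputable def leftMatrixHom : D →+* Matrix (Fin n) (Fin n) E where
  toFun := P.leftMatrix
  map_one' := by
    apply Matrix.mulVec_injective
    funext x
    rw [Matrix.one_mulVec, ← P.coord_sum x, ← coord_mul, one_mul]
  map_mul' a b := by
    apply Matrix.mulVec_injective
    funext x
    rw [← Matrix.mulVec_mulVec, ← P.coord_sum x, ← coord_mul, ← coord_mul, ← coord_mul, mul_assoc]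
  map_zero' := by
    apply Matrix.mulVec_injective
    funext x
    rw [Matrix.zero_mulVec, ← P.coord_sum x, ← coord_mul, zero_mul, ← coordEquiv_apply, map_zero]
  map_add' a b := by
    apply Matrix.mulVec_injective
    funext x
    rw [Matrix.add_mulVec, ← P.coord_sum x, ← coord_mul, ← coord_mul, ← coord_mul, add_mul]
    simp only [← coordEquiv_apply, map_add]

/-- `psi` as a ring homomorphism. -/
noncomputable def psiHom (ι : E →ₐ[GaussQ] ℂ) : D →+* Matrix (Fin n) (Fin n) ℂ :=
  (RingHom.mapMatrix (ι : E →+* ℂ)).comp P.leftMatrixHom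

/-- Applying `σ` to the coordinates of `a` gives `a'` with `a u = u a'`. The matrices of `a` and
`a'` are thus conjugate, while the latter is `σ` applied entrywise to the former. -/
theorem det_leftMatrix_fixed (hu : IsUnit P.u) (a : D) :
    σ (P.leftMatrix a).det = (P.leftMatrix a).det := by
  set a' : D := ∑ i : Fin n, P.u ^ (i : ℕ) * P.incl (σ (P.coord a i)) with ha'
  have h1 : a * P.u = P.u * a' := by
    conv_lhs => rw [← P.sum_coord a, Finset.sum_mul]
    rw [ha', Finset.mul_sum]
    refine Finset.sum_congr rfl fun i _ => ?_
    rw [mul_assoc, P.incl_mul_u, ← mul_assoc, ← mul_assoc, ← pow_succ, ← pow_succ']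
  have h2 : P.leftMatrix a' = (P.leftMatrix a).map σ := by
    ext r c
    simp only [leftMatrix, Matrix.of_apply, Matrix.map_apply, map_mul]
    congr 1
    · split_ifs <;> simp
    · rw [ha', coord_sum, ← AlgEquiv.mul_apply, ← AlgEquiv.mul_apply, ← pow_succ, ← pow_succ']
  have h3 := congrArg (fun x => (P.leftMatrixHom x).det) h1
  simp only [map_mul, Matrix.det_mul] at h3
  have hdu : IsUnit (P.leftMatrixHom P.u).det :=
    (Matrix.isUnit_iff_isUnit_det _).1 (hu.map P.leftMatrixHom)
  rw [mul_comm] at h3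
  have h4 : (P.leftMatrix a).det = (P.leftMatrix a').det := hdu.mul_left_cancel h3
  conv_rhs => rw [h4, h2]
  exact (σ : E →+* E).map_det _

variable [FiniteDimensional GaussQ E]

theorem exists_det_leftMatrix_eq_algebraMap [IsGalois GaussQ E]
    (hσ : ∀ τ : E ≃ₐ[GaussQ] E, τ ∈ Subgroup.zpowers σ) (hu : IsUnit P.u) (a : D) :
    ∃ z : GaussQ, algebraMap GaussQ E z = (P.leftMatrix a).det := by
  have h : (P.leftMatrix a).det ∈ Set.range (algebraMap GaussQ E) := by
    rw [IsGalois.mem_range_algebraMap_iff_fixed]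
    intro τ
    have hle : Subgroup.zpowers σ ≤ MulAction.stabilizer (E ≃ₐ[GaussQ] E) (P.leftMatrix a).det := by
      rw [Subgroup.zpowers_le]
      exact P.det_leftMatrix_fixed hu a
    exact hle (hσ τ)
  exact h

theorem det_mulLeft (a : D) :
    LinearMap.det (LinearMap.mulLeft GaussQ a) = Algebra.norm GaussQ (P.leftMatrix a).det := by
  rw [← LinearMap.det_toLin', ← LinearMap.det_restrictScalars,
    ← LinearMap.det_conj (LinearMap.mulLeft GaussQ a) P.coordEquiv]
  congr 1
  refine LinearMap.ext fun x => ?_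
  obtain ⟨b, rfl⟩ := P.coordEquiv.surjective x
  rw [LinearMap.comp_apply, LinearMap.comp_apply, LinearEquiv.coe_coe, LinearEquiv.coe_coe,
    LinearEquiv.symm_apply_apply, LinearMap.mulLeft_apply, coordEquiv_apply, coordEquiv_apply,
    coord_mul]
  rfl

end CyclicPresentation

/-! ### Comparing an order with its rational span -/

section Order

variable {D : Type*} [DivisionRing D] [CharZero D] {Λ : Subring D}

/-- This turns a `ℤ`-basis of `Λ` into a `ℚ`-basis of `D`, so rank and norm can be computed on
either side. -/
theorem IsZOrder.isLocalizedModule (hΛ : IsZOrder Λ) :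
    IsLocalizedModule (nonZeroDivisors ℤ) (Λ.subtype.toAddMonoidHom.toIntLinearMap) where
  map_units m := by
    have hm : ((m : ℤ) : D) ≠ 0 := Int.cast_ne_zero.2 (nonZeroDivisors.coe_ne_zero m)
    rw [Module.End.isUnit_iff]
    refine ⟨fun x y h => ?_, fun y => ⟨((m : ℤ) : D)⁻¹ * y, ?_⟩⟩
    · simp only [Module.algebraMap_end_apply, zsmul_eq_mul] at h
      exact mul_left_cancel₀ hm h
    · simp only [Module.algebraMap_end_apply, zsmul_eq_mul]
      rw [← mul_assoc, mul_inv_cancel₀ hm, one_mul]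
  surj y := by
    have hy : y ∈ Submodule.span ℚ (Λ : Set D) := hΛ.2 ▸ Submodule.mem_top
    induction hy using Submodule.span_induction with
    | mem x hx => exact ⟨(⟨x, hx⟩, 1), by simp⟩
    | zero => exact ⟨(0, 1), by simp⟩
    | add x y _ _ hx hy =>
      obtain ⟨⟨a, s⟩, ha⟩ := hx
      obtain ⟨⟨b, t⟩, hb⟩ := hy
      refine ⟨(t • a + s • b, s * t), ?_⟩
      simp only [smul_add, map_add, Submonoid.smul_def, map_zsmul] at ha hb ⊢
      rw [← ha, ← hb, Submonoid.coe_mul, mul_smul, mul_comm, mul_smul, smul_comm (t : ℤ) (s : ℤ) y,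
        smul_comm]
    | smul q x _ hx =>
      obtain ⟨⟨a, s⟩, ha⟩ := hx
      refine ⟨(q.num • a, ⟨(q.den : ℤ), by simp⟩ * s), ?_⟩
      simp only [Submonoid.smul_def, map_zsmul, Submonoid.coe_mul] at ha ⊢
      have hq : (q.den : ℤ) • (q • x) = q.num • x := by
        rw [← Int.cast_smul_eq_zsmul ℚ, smul_smul, Int.cast_natCast, Rat.den_mul_eq_num,
          Int.cast_smul_eq_zsmul]
      rw [← ha, mul_comm, mul_smul, hq, smul_comm]
  exists_of_eq h := ⟨1, by rw [Subtype.val_injective h]⟩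

theorem IsZOrder.finrank_eq (hΛ : IsZOrder Λ) : Module.finrank ℤ Λ = Module.finrank ℚ D := by
  have := hΛ.1
  have := hΛ.isLocalizedModule
  let b := Module.Free.chooseBasis ℤ Λ
  rw [Module.finrank_eq_card_basis b, Module.finrank_eq_card_basis
    (b.ofIsLocalizedModule ℚ (nonZeroDivisors ℤ) Λ.subtype.toAddMonoidHom.toIntLinearMap)]

theorem IsZOrder.norm_eq (hΛ : IsZOrder Λ) (x : Λ) :
    ((Algebra.norm ℤ x : ℤ) : ℚ) = Algebra.norm ℚ (x : D) := by
  classical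
  have := hΛ.1
  have := hΛ.isLocalizedModule
  let b := Module.Free.chooseBasis ℤ Λ
  let b' := b.ofIsLocalizedModule ℚ (nonZeroDivisors ℤ) Λ.subtype.toAddMonoidHom.toIntLinearMap
  rw [Algebra.norm_eq_matrix_det b, Algebra.norm_eq_matrix_det b', ← eq_intCast (Int.castRingHom ℚ),
    RingHom.map_det]
  congr 1
  ext i j
  simp only [RingHom.mapMatrix_apply, Matrix.map_apply, Algebra.leftMulMatrix_eq_repr_mul]
  rw [Module.Basis.ofIsLocalizedModule_apply]
  exact (b.ofIsLocalizedModule_repr_apply ℚ (nonZeroDivisors ℤ)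
    Λ.subtype.toAddMonoidHom.toIntLinearMap (x * b j) i).symm

end Order

/-! ### The norm as a power of the determinant, and the conclusion -/

namespace CyclicPresentation

variable {E : Type*} [Field E] [Algebra GaussQ E] {σ : E ≃ₐ[GaussQ] E} {γ : GaussQ} {n : ℕ}
  {D : Type*} [DivisionRing D] [CharZero D] [Algebra GaussQ D] (P : CyclicPresentation σ γ n D)

theorem isUnit_u (hn : 0 < n) (hγ : γ ≠ 0) : IsUnit P.u := by
  rw [isUnit_iff_ne_zero]
  intro hu
  have := P.u_pow
  rw [hu, zero_pow hn.ne'] at this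
  exact hγ ((map_eq_zero (algebraMap GaussQ D)).1 this.symm)

variable [FiniteDimensional GaussQ E]

theorem finrank_rat (P : CyclicPresentation σ γ n D) (hn : Module.finrank GaussQ E = n) : Module.finrank ℚ D = 2 * n ^ 2 := by
  rw [← Module.finrank_mul_finrank ℚ GaussQ D, finrank_gaussQ, P.coordEquiv.finrank_eq,
    Module.finrank_pi_fintype]
  simp [hn, sq]

/-- The determinant is some `z ∈ ℚ(i)`. Its norm from `E` is `z^n`, and the norm from `ℚ(i)` to `ℚ`
is the squared absolute value. -/
theorem norm_rat_eq [IsGalois GaussQ E] (hn : Module.finrank GaussQ E = n)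
    (hσ : ∀ τ : E ≃ₐ[GaussQ] E, τ ∈ Subgroup.zpowers σ) (hγ : γ ≠ 0) (ι : E →ₐ[GaussQ] ℂ) (a : D) :
    ((Algebra.norm ℚ a : ℚ) : ℝ) = ‖(P.psi ι a).det‖ ^ (2 * n) := by
  have hn0 : 0 < n := hn ▸ Module.finrank_pos
  obtain ⟨z, hz⟩ := P.exists_det_leftMatrix_eq_algebraMap hσ (P.isUnit_u hn0 hγ) a
  have : FiniteDimensional GaussQ D := P.coordEquiv.symm.finiteDimensional
  have h1 : Algebra.norm ℚ a = Algebra.norm ℚ (LinearMap.det (LinearMap.mulLeft GaussQ a)) := by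
    rw [← LinearMap.det_restrictScalars]
    rfl
  have h2 : (P.psi ι a).det = (z : ℂ) := by
    rw [psi_eq_map]
    have h3 := (ι : E →+* ℂ).map_det (P.leftMatrix a)
    rw [← hz] at h3
    exact h3.symm.trans (ι.commutes z)
  rw [h1, P.det_mulLeft, ← hz, Algebra.norm_algebraMap, hn, map_pow, Rat.cast_pow, norm_gaussQ, h2,
    ← pow_mul]

theorem norm_int_eq [IsGalois GaussQ E] (hn : Module.finrank GaussQ E = n)
    (hσ : ∀ τ : E ≃ₐ[GaussQ] E, τ ∈ Subgroup.zpowers σ) (hγ : γ ≠ 0) (ι : E →ₐ[GaussQ] ℂ)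
    {Λ : Subring D} (hΛ : IsZOrder Λ) (x : Λ) :
    ((Algebra.norm ℤ x).natAbs : ℝ) = ‖(((P.psiHom ι).comp Λ.subtype) x).det‖ ^ (2 * n) := by
  have h := P.norm_rat_eq hn hσ hγ ι (x : D)
  rw [← hΛ.norm_eq] at h
  change _ = ‖(P.psi ι (x : D)).det‖ ^ (2 * n)
  rw [← h, Nat.cast_natAbs, Int.cast_abs, Rat.cast_intCast, abs_of_nonneg]
  rw [Rat.cast_intCast] at h
  rw [h]
  positivity

end CyclicPresentation

theorem proposition4p5
    {E : Type*} [Field E] [Algebra GaussQ E] [FiniteDimensional GaussQ E] [IsGalois GaussQ E]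
    (n : ℕ) (hn : Module.finrank GaussQ E = n)
    (σ : E ≃ₐ[GaussQ] E) (hσ : ∀ τ : E ≃ₐ[GaussQ] E, τ ∈ Subgroup.zpowers σ)
    (γ : GaussQ) (hγ : γ ≠ 0)
    {D : Type*} [DivisionRing D] [CharZero D] [Algebra GaussQ D]
    (P : CyclicPresentation σ γ n D) (ι : E →ₐ[GaussQ] ℂ)
    (Λ : Subring D) (hΛ : IsZOrder Λ)
    (nr : ℕ) (hnr : 2 ≤ nr) :
    (∀ R : ℝ, {x : D | x ∈ Λ ∧ ‖P.psi ι x‖ ≤ R}.Finite) ∧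
    ∃ M : ℝ, ∀ R : ℝ, 0 < R →
      ∑ᶠ x ∈ {x : D | x ∈ Λ ∧ x ≠ 0 ∧ ‖P.psi ι x‖ ≤ R}, 1 / ‖(P.psi ι x).det‖ ^ (2 * n * nr) ≤
        M * (Set.range (fun v : Λˣ => P.psi ι ((v : Λ) : D)) ∩
          {X : Matrix (Fin n) (Fin n) ℂ | ‖X‖ ≤ R ^ n}).ncard := by
  have hn0 : 0 < n := hn ▸ Module.finrank_pos
  have hfg := hΛ.1
  let ψ : Λ →+* Matrix (Fin n) (Fin n) ℂ := (P.psiHom ι).comp Λ.subtype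
  have hψ : ∀ x : Λ, ((Algebra.norm ℤ x).natAbs : ℝ) = ‖(ψ x).det‖ ^ (2 * n) :=
    P.norm_int_eq hn hσ hγ ι hΛ
  have hfin := finite_setOf_norm_le_of_norm_eq ψ hn0 hψ
  refine ⟨fun R => ?_, ?_⟩
  · refine ((hfin R).image Subtype.val).subset ?_
    rintro x ⟨hx, hR⟩
    exact ⟨⟨x, hx⟩, hR, rfl⟩
  · obtain ⟨M, hM⟩ := exists_sum_inv_det_pow_le ψ hn0 hψ
      (hΛ.finrank_eq.trans (P.finrank_rat hn)) hnr
    refine ⟨M, fun R _ => ?_⟩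
    have hS : {x : Λ | x ≠ 0 ∧ ‖ψ x‖ ≤ R}.Finite := (hfin R).subset fun x hx => hx.2
    have himage : {x : D | x ∈ Λ ∧ x ≠ 0 ∧ ‖P.psi ι x‖ ≤ R} =
        Subtype.val '' {x : Λ | x ≠ 0 ∧ ‖ψ x‖ ≤ R} := by
      ext x
      constructor
      · rintro ⟨hx, hx0, hR⟩
        exact ⟨⟨x, hx⟩, ⟨fun h => hx0 (congrArg Subtype.val h), hR⟩, rfl⟩
      · rintro ⟨y, ⟨hy0, hR⟩, rfl⟩
        exact ⟨y.2, fun h => hy0 (Subtype.ext h), hR⟩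
    -- Finiteness of the index set makes the `finsum` a genuine sum, not its default value 0.
    rw [himage, finsum_mem_image Subtype.val_injective.injOn, finsum_mem_eq_finite_toFinset_sum _ hS]
    exact hM R hS.toFinset fun x hx => hS.mem_toFinset.1 hx
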